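/- Let $L>0$, $R>0$, let $N\ge 1$ and $d\ge 3N+1$ be integers, and define $\theta_0=1$, $\theta_i=\frac{1+\sqrt{1+4\theta_{i-1}^2}}{2}$ for $1\le i\le N-1$ and $\theta_N=\frac{1+\sqrt{1+8\theta_{N-1}^2}}{2}$. A function $f\colon\mathbb{R}^d\to\mathbb{R}$ is called $L$-smooth if it is differentiable with $L$-Lipschitz gradient. For a closed convex proper function $h\colon\mathbb{R}^d\to\mathbb{R}\cup\{\infty\}$ and $\gamma>0$, let $\mathbf{prox}_{\gamma h}(x)=\operatorname{argmin}_{z}\{h(z)+\frac{1}{2\gamma}\|z-x\|^2\}$, where $\|\cdot\|$ is the Euclidean norm. A deterministic $N$-step double-oracle method proceeds, for $L$-smooth convex $f$, closed convex proper $h$ and a starting point $x_0=z_0$, as follows. At each step $i=0,\dots,2N-1$ it chooses a query point $z_i$ (with $z_0=x_0$ given), one of two oracles, and a stepsize $\gamma_i>0$, and it receives either $(\nabla f(z_i),f(z_i))$ from the gradient oracle or $(\mathbf{prox}_{\gamma_i h}(z_i),h(z_i))$ from the proximal oracle. After these $2N$ steps it returns an output $x_N\in\mathbb{R}^d$. Every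 choice, and the output, is a function only of the starting point and of the previous queries and oracle answers (no span condition is imposed). In every run each of the two oracles is called exactly $N$ times, in any order. Then for every starting point $x_0\in\mathbb{R}^d$ and every deterministic $N$-step double-oracle method there exist an $L$-smooth convex function $f\colon\mathbb{R}^d\to\mathbb{R}$, a function $h\colon\mathbb{R}^d\to\mathbb{R}\cup\{\infty\}$ that is the indicator function ($0$ on the set, $\infty$ off it) of a nonempty closed convex set, and a point $x_\star\in\operatorname{argmin}(f+h)$ such that $\|x_0-x_\star\|=R$ and the output $x_N$ of the method on $(f,h)$ from $x_0$ satisfies \[ f(x_N)+h(x_N)-f(x_\star)-h(x_\star)\ \ge\ \frac{L\|x_0-x_\star\|^2}{2(\theta_N^2-1)} . \] -/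

import Mathlib

/-- The `θ`-coefficients for a total iteration count `N`: `θ₀ = 1`,
`θᵢ = (1 + √(1 + 4 θᵢ₋₁²)) / 2` for `1 ≤ i ≤ N - 1`, and
`θ_N = (1 + √(1 + 8 θ_{N-1}²)) / 2`. (Indices above `N` are not used.) -/
noncomputable def theta (N : ℕ) : ℕ → ℝ
  | 0 => 1
  | i + 1 =>
    if i + 1 = N then (1 + Real.sqrt (1 + 8 * theta N i ^ 2)) / 2
    else (1 + Real.sqrt (1 + 4 * theta N i ^ 2)) / 2

/-- `f : ℝᵈ → ℝ` is `L`-smooth and convex: convex and differentiable, with an `L`-Lipschitz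
gradient. -/
structure IsSmoothConvex {d : ℕ} (L : ℝ) (f : EuclideanSpace ℝ (Fin d) → ℝ) : Prop where
  convex : ConvexOn ℝ Set.univ f
  differentiable : Differentiable ℝ f
  lipschitz : ∀ x y, ‖gradient f x - gradient f y‖ ≤ L * ‖x - y‖

/-- `h : ℝᵈ → ℝ ∪ {∞}` is closed (lower semicontinuous), convex and proper. -/
structure IsClosedConvexProper {d : ℕ} (h : EuclideanSpace ℝ (Fin d) → EReal) : Prop where
  ne_bot : ∀ x, h x ≠ ⊥
  exists_ne_top : ∃ x, h x ≠ ⊤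
  convex : ∀ x y, ∀ t : ℝ, 0 < t → t < 1 →
    h (t • x + (1 - t) • y) ≤ (t : EReal) * h x + ((1 - t : ℝ) : EReal) * h y
  closed : LowerSemicontinuous h

open Classical in
/-- The indicator function `δ_C` of convex analysis: `0` on `C` and `∞` off `C`. -/
noncomputable def convexIndicator {d : ℕ} (C : Set (EuclideanSpace ℝ (Fin d))) :
    EuclideanSpace ℝ (Fin d) → EReal :=
  fun x => if x ∈ C then 0 else ⊤

/-- `h` is the indicator function of a nonempty closed convex set. -/
def IsConvexIndicator {d : ℕ} (h : EuclideanSpace ℝ (Fin d) → EReal) : Prop :=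
  ∃ C : Set (EuclideanSpace ℝ (Fin d)),
    C.Nonempty ∧ IsClosed C ∧ Convex ℝ C ∧ h = convexIndicator C

/-- The proximal operator `prox_{γh}(x) = argmin_z { h z + ‖z - x‖² / (2γ) }`. For `γ > 0` and `h`
closed, convex and proper, the minimizer exists and is unique. -/
noncomputable def prox {d : ℕ} (γ : ℝ) (h : EuclideanSpace ℝ (Fin d) → EReal)
    (x : EuclideanSpace ℝ (Fin d)) : EuclideanSpace ℝ (Fin d) :=
  Classical.epsilon fun p =>
    IsMinOn (fun z => h z + ((‖z - x‖ ^ 2 / (2 * γ) : ℝ) : EReal)) Set.univ p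

/-- Which of the two oracles is called: the gradient oracle of `f` or the proximal oracle
of `h`. -/
inductive OracleKind
  | gradient
  | proximal
  deriving DecidableEq

/-- A query `(z, δ, γ)`: a point, the oracle to be called there, and a positive proximal
stepsize (which the gradient oracle ignores). -/
structure OracleQuery (d : ℕ) where
  point : EuclideanSpace ℝ (Fin d)
  kind : OracleKind
  stepsize : {γ : ℝ // 0 < γ}

/-- The answer of an oracle: a gradient together with a value of `f`, or a proximal point together
with a value of `h`. -/
inductive OracleAnswer (d : ℕ)
  | ofGradient (g : EuclideanSpace ℝ (Fin d)) (value : ℝ)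
  | ofProximal (p : EuclideanSpace ℝ (Fin d)) (value : EReal)

/-- The oracles: `O_f(z) = (∇f(z), f(z))` and `O_h(z, γ) = (prox_{γh}(z), h(z))`. -/
noncomputable def oracleAnswer {d : ℕ} (f : EuclideanSpace ℝ (Fin d) → ℝ)
    (h : EuclideanSpace ℝ (Fin d) → EReal) (q : OracleQuery d) : OracleAnswer d :=
  match q.kind with
  | OracleKind.gradient => OracleAnswer.ofGradient (gradient f q.point) (f q.point)
  | OracleKind.proximal =>
    OracleAnswer.ofProximal (prox q.stepsize.1 h q.point) (h q.point)

/-- A deterministic strategy. `first` chooses the oracle and the stepsize for the first query, whose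
point is the starting point; `next` chooses each later query, and `output` the approximate solution,
from the list of all earlier queries and their answers. -/
structure DoubleOracleStrategy (d : ℕ) where
  first : EuclideanSpace ℝ (Fin d) → OracleKind × {γ : ℝ // 0 < γ}
  next : List (OracleQuery d × OracleAnswer d) → OracleQuery d
  output : List (OracleQuery d × OracleAnswer d) → EuclideanSpace ℝ (Fin d)

namespace DoubleOracleStrategy

/-- The next query of the strategy started at `x₀`, given the queries and answers so far. -/
def query {d : ℕ} (A : DoubleOracleStrategy d) (x₀ : EuclideanSpace ℝ (Fin d)) :
    List (OracleQuery d × OracleAnswer d) → OracleQuery d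
  | [] => ⟨x₀, (A.first x₀).1, (A.first x₀).2⟩
  | s :: H => A.next (s :: H)

/-- The first `k` queries and answers of the strategy run on `(f, h)` from `x₀`, in chronological
order. -/
noncomputable def history {d : ℕ} (A : DoubleOracleStrategy d)
    (f : EuclideanSpace ℝ (Fin d) → ℝ) (h : EuclideanSpace ℝ (Fin d) → EReal)
    (x₀ : EuclideanSpace ℝ (Fin d)) : ℕ → List (OracleQuery d × OracleAnswer d)
  | 0 => []
  | k + 1 =>
    let H := A.history f h x₀ k
    H ++ [(A.query x₀ H, oracleAnswer f h (A.query x₀ H))]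

end DoubleOracleStrategy

/-- A deterministic `N`-step double-oracle method for the problems of minimizing `f + h` with `f`
`L`-smooth convex and `h` closed convex proper: a deterministic strategy which, on each of these
problems and from each starting point, among its `2N` queries makes exactly `N` gradient queries and
exactly `N` proximal queries, in any order. -/
structure DoubleOracleMethod (d N : ℕ) (L : ℝ) extends DoubleOracleStrategy d where
  gradient_count : ∀ f h x₀, IsSmoothConvex L f → IsClosedConvexProper h →
    (toDoubleOracleStrategy.history f h x₀ (2 * N)).countP
      (fun s => s.1.kind = OracleKind.gradient) = N
  proximal_count : ∀ f h x₀, IsSmoothConvex L f → IsClosedConvexProper h →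
    (toDoubleOracleStrategy.history f h x₀ (2 * N)).countP
      (fun s => s.1.kind = OracleKind.proximal) = N

/-- The output `x_N` of the method run on `(f, h)` from the starting point `x₀`, after its `2N`
oracle calls. -/
noncomputable def DoubleOracleMethod.result {d N : ℕ} {L : ℝ} (A : DoubleOracleMethod d N L)
    (f : EuclideanSpace ℝ (Fin d) → ℝ) (h : EuclideanSpace ℝ (Fin d) → EReal)
    (x₀ : EuclideanSpace ℝ (Fin d)) : EuclideanSpace ℝ (Fin d) :=
  A.output (A.history f h x₀ (2 * N))

/-! The worst case is built on `N + 1` orthonormal directions `e i`, with `u i` the coordinates of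
`x - x₀`. The function `f` is the maximum over the simplex of the affine forms `t i * u i + b i`
minus a quadratic penalty in the weights; the penalty makes it `L`-smooth. The function `h` is the
indicator of the box `u i ≥ -c i`.

The `b i` decrease so fast that, where all coordinates from `m` on vanish, the gradient involves no
direction beyond `e m` (`chainArgmax_eq_zero`). The projection onto the box leaves vanishing
coordinates alone, as `-c i < 0`. So a gradient call reveals at most one new direction and a
proximal call none (`oracleAnswer_congr`). Without a span condition, a resisting oracle fixes the
directions adaptively: unrevealed ones are re-chosen orthogonal to all queries, which leaves the
transcript unchanged (`IsHidden.exists_replace`). After `N` gradient calls and the output, `e N` is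
still hidden, so the output has `u N = 0`, and putting all weight on index `N` gives `f ≥ b N - t N
^ 2 / (2 * L)` there.

The corner `u = -c` and the weights `w` form a saddle point, so the constrained minimum is `v = ∑ t
i ^ 2 * w i ^ 2 / (2 * L)`. The `θ`-recursion supplies parameters that put the corner at distance
`R` and make the gap equal to the bound (`exists_worst_case_parameters`). -/

/-! ### The `θ`-sequence and the weights derived from it. -/

section ThetaSequence

theorem one_le_theta (N i : ℕ) : 1 ≤ theta N i := by
  induction i with
  | zero => simp [theta]
  | succ i ih =>
    rw [theta]
    split_ifs
    · have : 1 ≤ √(1 + 8 * theta N i ^ 2) := Real.one_le_sqrt.2 (by nlinarith)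
      linarith
    · have : 1 ≤ √(1 + 4 * theta N i ^ 2) := Real.one_le_sqrt.2 (by nlinarith)
      linarith

theorem theta_succ_sq {N i : ℕ} (h : i + 1 ≠ N) :
    theta N (i + 1) ^ 2 - theta N (i + 1) = theta N i ^ 2 := by
  rw [theta, if_neg h]
  have := Real.sq_sqrt (show 0 ≤ 1 + 4 * theta N i ^ 2 by positivity)
  linear_combination this / 4

theorem theta_last_sq (i : ℕ) :
    theta (i + 1) (i + 1) ^ 2 - theta (i + 1) (i + 1) = 2 * theta (i + 1) i ^ 2 := by
  rw [theta, if_pos rfl]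
  have := Real.sq_sqrt (show 0 ≤ 1 + 8 * theta (i + 1) i ^ 2 by positivity)
  linear_combination this / 4

theorem sum_theta (N i : ℕ) (h : i < N) :
    ∑ k ∈ Finset.range (i + 1), theta N k = theta N i ^ 2 := by
  induction i with
  | zero => simp [theta]
  | succ i ih =>
    rw [Finset.sum_range_succ, ih (by omega), ← theta_succ_sq (N := N) (i := i) (by omega)]
    ring

theorem one_lt_theta_last {N : ℕ} (hN : 0 < N) : 1 < theta N N := by
  obtain ⟨n, rfl⟩ : ∃ n, N = n + 1 := ⟨N - 1, by omega⟩
  nlinarith [theta_last_sq n, one_le_theta (n + 1) n, one_le_theta (n + 1) (n + 1)]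

/-- The weights and the squared slope ratios of the worst-case instance. -/
theorem exists_worst_case_weights {N : ℕ} (hN : 0 < N) :
    ∃ w s : ℕ → ℝ, (∀ k, 0 < w k) ∧ (∀ k, k ≤ N → 0 < s k) ∧
      ∑ k ∈ Finset.range (N + 1), w k = 1 ∧
      (∀ k, k < N → s k * (w k - 1 / theta N N ^ 2) = s (k + 1) * w (k + 1)) ∧
      s N * (2 * w N - 1 / theta N N ^ 2) = 1 ∧
      ∑ k ∈ Finset.range (N + 1), s k * w k ^ 2 = 1 := by
  have hθ := one_lt_theta_last hN
  set θ := theta N N with hθdef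
  have hθ0 : 0 < θ := by linarith
  have hpos : ∀ k, 0 < theta N k := fun k => by linarith [one_le_theta N k]
  -- The total weight is `1` because `2 * θ_{N-1}² = θ² - θ`.
  let w : ℕ → ℝ := fun k => if k = N then 1 / θ else 2 * theta N k / θ ^ 2
  have hw : ∀ k, 0 < w k := fun k => by
    have := hpos k
    simp only [w]
    split_ifs <;> positivity
  have hwN : w N = 1 / θ := by simp [w]
  have hwlt : ∀ k, k < N → w k = 2 * theta N k / θ ^ 2 := fun k hk => by
    simp [w, hk.ne]
  have hgap : ∀ k, k < N → 0 < w k - 1 / θ ^ 2 := fun k hk => by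
    rw [hwlt k hk, ← sub_div]
    have := one_le_theta N k
    apply div_pos <;> [linarith; positivity]
  have hlast : 0 < 2 * w N - 1 / θ ^ 2 := by
    have : 2 * w N - 1 / θ ^ 2 = (2 * θ - 1) / θ ^ 2 := by
      rw [hwN]; field_simp
    rw [this]
    apply div_pos <;> [linarith; positivity]
  -- The recursion fixes `s` up to a factor; `σ` starts it at `1`, and division by `D` enforces the
  -- condition at index `N`.
  let σ : ℕ → ℝ := fun k => Nat.rec 1 (fun k x => x * (w k - 1 / θ ^ 2) / w (k + 1)) k
  have hσs : ∀ k, σ (k + 1) = σ k * (w k - 1 / θ ^ 2) / w (k + 1) := fun _ => rfl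
  have hσ : ∀ k, k ≤ N → 0 < σ k := by
    intro k
    induction k with
    | zero => intro _; exact one_pos
    | succ k ih =>
      intro hk
      rw [hσs]
      exact div_pos (mul_pos (ih (by omega)) (hgap k (by omega))) (hw _)
  set D := σ N * (2 * w N - 1 / θ ^ 2) with hD
  have hDpos : 0 < D := mul_pos (hσ N le_rfl) hlast
  have hW : ∀ m, m < N → ∑ k ∈ Finset.range (m + 1), w k = 2 * theta N m ^ 2 / θ ^ 2 := by
    intro m hm
    rw [← sum_theta N m hm, Finset.mul_sum, Finset.sum_div]
    exact Finset.sum_congr rfl fun k hk => hwlt k (by have := Finset.mem_range.1 hk; omega)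
  have hWN : ∑ k ∈ Finset.range N, w k = 1 - w N := by
    obtain ⟨n, rfl⟩ : ∃ n, N = n + 1 := ⟨N - 1, by omega⟩
    rw [hW n (by omega), ← theta_last_sq n, ← hθdef, hwN]
    field_simp
  have hrec : ∀ k, k < N →
      σ k / D * (w k - 1 / θ ^ 2) = σ (k + 1) / D * w (k + 1) := fun k hk => by
    rw [hσs]
    have := (hw (k + 1)).ne'
    field_simp
  -- A closed form for the partial sums. Its inductive step rests on `(w 0 + ... + w m) / θ² = w m ^
  -- 2 / 2`, which is `sum_theta` rescaled; at `m = N` it yields the last normalization.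
  have hP : ∀ m, m ≤ N → ∑ k ∈ Finset.range m, σ k / D * w k ^ 2 =
      2 * (∑ k ∈ Finset.range m, w k) * (σ m / D * w m) := by
    intro m
    induction m with
    | zero => simp
    | succ m ih =>
      intro hm
      rw [Finset.sum_range_succ, ih (by omega), ← hrec m (by omega)]
      have h1 : (∑ k ∈ Finset.range (m + 1), w k) * (1 / θ ^ 2) = w m ^ 2 / 2 := by
        rw [hW m (by omega), hwlt m (by omega)]
        field_simp
      have h2 := Finset.sum_range_succ w m
      linear_combination (2 * (σ m / D)) * h1 - 2 * (σ m / D) * w m * h2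
  have hN1 : σ N / D * (2 * w N - 1 / θ ^ 2) = 1 := by
    rw [div_mul_eq_mul_div, ← hD, div_self hDpos.ne']
  refine ⟨w, fun k => σ k / D, hw, fun k hk => div_pos (hσ k hk) hDpos, ?_, hrec, hN1, ?_⟩
  · rw [Finset.sum_range_succ, hWN]; ring
  · rw [Finset.sum_range_succ, hP N le_rfl, hWN]
    have : w N ^ 2 = 1 / θ ^ 2 := by rw [hwN]; field_simp
    linear_combination hN1 - (σ N / D) * this

end ThetaSequence

/-! ### The smooth function with gradients that reveal one direction at a time. -/

section ChainFunction

/-- The concave objective on the simplex whose maximum is the chain function. -/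
noncomputable def chainObjective {n : ℕ} (L : ℝ) (t b u α : Fin n → ℝ) : ℝ :=
  ∑ i, (α i * (t i * u i + b i) - t i ^ 2 * α i ^ 2 / (2 * L))

theorem exists_isMaxOn_chainObjective {n : ℕ} (L : ℝ) (t b u : Fin (n + 1) → ℝ) :
    ∃ α ∈ stdSimplex ℝ (Fin (n + 1)),
      IsMaxOn (chainObjective L t b u) (stdSimplex ℝ (Fin (n + 1))) α := by
  refine (isCompact_stdSimplex ℝ (Fin (n + 1))).exists_isMaxOn
    ⟨Pi.single 0 1, single_mem_stdSimplex ℝ 0⟩ ?_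
  unfold chainObjective
  fun_prop

/-- A maximizer of the chain objective over the simplex. -/
noncomputable def chainArgmax {n : ℕ} (L : ℝ) (t b u : Fin (n + 1) → ℝ) : Fin (n + 1) → ℝ :=
  Classical.choose (exists_isMaxOn_chainObjective L t b u)

theorem chainArgmax_mem {n : ℕ} (L : ℝ) (t b u : Fin (n + 1) → ℝ) :
    chainArgmax L t b u ∈ stdSimplex ℝ (Fin (n + 1)) :=
  (Classical.choose_spec (exists_isMaxOn_chainObjective L t b u)).1

theorem chainObjective_le {n : ℕ} (L : ℝ) (t b u : Fin (n + 1) → ℝ) {α : Fin (n + 1) → ℝ}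
    (hα : α ∈ stdSimplex ℝ (Fin (n + 1))) :
    chainObjective L t b u α ≤ chainObjective L t b u (chainArgmax L t b u) :=
  (Classical.choose_spec (exists_isMaxOn_chainObjective L t b u)).2 hα

/-- First-order optimality of the maximizer. -/
theorem chainArgmax_variational {n : ℕ} (L : ℝ) (t b u : Fin (n + 1) → ℝ)
    {β : Fin (n + 1) → ℝ} (hβ : β ∈ stdSimplex ℝ (Fin (n + 1))) :
    ∑ i, (β i - chainArgmax L t b u i) *
      (t i * u i + b i - t i ^ 2 * chainArgmax L t b u i / L) ≤ 0 := by
  set α := chainArgmax L t b u with hα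
  set D := ∑ i, (β i - α i) * (t i * u i + b i - t i ^ 2 * α i / L) with hD
  set Q := ∑ i, t i ^ 2 * (β i - α i) ^ 2 / (2 * L) with hQ
  -- Moving a fraction `s` of the way to `β` changes the quadratic objective by `s * D - s ^ 2 * Q`,
  -- which cannot be positive.
  have key : ∀ s : ℝ, 0 < s → s ≤ 1 → D ≤ s * Q := by
    intro s hs hs1
    have hmem := (convex_stdSimplex ℝ (Fin (n + 1))) (chainArgmax_mem L t b u) hβ
      (sub_nonneg.2 hs1) hs.le (by ring)
    have h := chainObjective_le L t b u hmem
    have e : chainObjective L t b u ((1 - s) • α + s • β) =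
        chainObjective L t b u α + s * D - s ^ 2 * Q := by
      simp only [chainObjective, hD, hQ, Finset.mul_sum, ← Finset.sum_add_distrib,
        ← Finset.sum_sub_distrib, Pi.add_apply, Pi.smul_apply, smul_eq_mul]
      refine Finset.sum_congr rfl fun i _ => ?_
      have : t i ^ 2 * α i / L = 2 * (t i ^ 2 * α i / (2 * L)) := by
        rw [mul_comm 2 L, ← div_div]
        ring
      rw [this]
      ring
    rw [← hα, e] at h
    have : s * D ≤ s * (s * Q) := by nlinarith
    exact le_of_mul_le_mul_left this hs
  by_contra! hpos
  have h1 := key 1 one_pos le_rfl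
  have hQpos : 0 < Q := by linarith
  have h2 := key (D / (2 * Q)) (by positivity) (by
    rw [div_le_one (by positivity)]; linarith)
  have : D / (2 * Q) * Q = D / 2 := by field_simp
  linarith

/-- A vanishing tail of coordinates activates at most one further index. -/
theorem chainArgmax_eq_zero {n : ℕ} {L : ℝ} (hL : 0 < L) {t b u : Fin (n + 1) → ℝ}
    (ht : ∀ i, 0 < t i) (hb : ∀ i j, i < j → b j ≤ b i - t i ^ 2 / L) {m j : Fin (n + 1)}
    (hu : ∀ i, m ≤ i → u i = 0) (hmj : m < j) : chainArgmax L t b u j = 0 := by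
  have hmem := chainArgmax_mem L t b u
  have hvar := fun {β} => chainArgmax_variational L t b u (β := β)
  set α := chainArgmax L t b u
  by_contra hne
  -- Test against shifting all the mass at `j` to `m`. The marginal value at `m` is at least `b m -
  -- t m ^ 2 / L ≥ b j`, while the one at `j` lies strictly below `b j`, so the shift would improve
  -- the objective.
  let δ : Fin (n + 1) → Fin (n + 1) → ℝ := fun k => Pi.single k (α j)
  have hj : 0 < α j := lt_of_le_of_ne (hmem.1 j) (Ne.symm hne)
  have hm1 : α m ≤ 1 := by
    rw [← hmem.2]
    exact Finset.single_le_sum (fun i _ => hmem.1 i) (Finset.mem_univ m)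
  have hsum : ∀ F : Fin (n + 1) → ℝ,
      ∑ i, (δ m i - δ j i) * F i = α j * (F m - F j) := by
    intro F
    simp only [δ, sub_mul, Finset.sum_sub_distrib, Pi.single_apply, ite_mul, zero_mul,
      Finset.sum_ite_eq', Finset.mem_univ, if_true]
    ring
  have hβ : (fun i => α i + (δ m i - δ j i)) ∈
      stdSimplex ℝ (Fin (n + 1)) := by
    constructor
    · intro i
      have h0 := hmem.1 i
      simp only [δ, Pi.single_apply]
      split_ifs with h1 h2 h2
      · linarith
      · linarith
      · subst h2; linarith
      · linarith
    · have := hsum 1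
      simp only [Pi.one_apply, mul_one, sub_self, mul_zero] at this
      rw [Finset.sum_add_distrib, this, hmem.2, add_zero]
  have h := hvar hβ
  simp only [add_sub_cancel_left] at h
  rw [hsum, hu m le_rfl, hu j hmj.le] at h
  have h1 := hb m j hmj
  have h2 : t m ^ 2 * α m / L ≤ t m ^ 2 / L := by
    gcongr
    exact mul_le_of_le_one_right (by positivity) hm1
  have h3 : 0 < t j ^ 2 * α j / L := by
    have := ht j
    positivity
  nlinarith

/-- The coordinates of `x - x₀` along the directions `e`. -/
noncomputable def chainCoord {d n : ℕ} (e : Fin n → EuclideanSpace ℝ (Fin d))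
    (x₀ x : EuclideanSpace ℝ (Fin d)) : Fin n → ℝ :=
  fun i => inner ℝ (e i) (x - x₀)

/-- The smoothed maximum of the affine functions `t i * u i + b i`, where `u` are the coordinates
of `x - x₀` along `e`. -/
noncomputable def chainFunction {d n : ℕ} (L : ℝ) (t b : Fin (n + 1) → ℝ)
    (e : Fin (n + 1) → EuclideanSpace ℝ (Fin d)) (x₀ x : EuclideanSpace ℝ (Fin d)) : ℝ :=
  chainObjective L t b (chainCoord e x₀ x) (chainArgmax L t b (chainCoord e x₀ x))

/-- The gradient of the chain function. -/
noncomputable def chainGradient {d n : ℕ} (L : ℝ) (t b : Fin (n + 1) → ℝ)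
    (e : Fin (n + 1) → EuclideanSpace ℝ (Fin d)) (x₀ x : EuclideanSpace ℝ (Fin d)) :
    EuclideanSpace ℝ (Fin d) :=
  ∑ i, (t i * chainArgmax L t b (chainCoord e x₀ x) i) • e i

variable {d n : ℕ} {L : ℝ} {t b : Fin (n + 1) → ℝ}
  {e : Fin (n + 1) → EuclideanSpace ℝ (Fin d)} {x₀ : EuclideanSpace ℝ (Fin d)}

theorem chainCoord_sub (x y : EuclideanSpace ℝ (Fin d)) (i : Fin (n + 1)) :
    chainCoord e x₀ y i - chainCoord e x₀ x i = inner ℝ (e i) (y - x) := by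
  rw [chainCoord, chainCoord, ← inner_sub_right, sub_sub_sub_cancel_right]

theorem chainFunction_subgradient (x y : EuclideanSpace ℝ (Fin d)) :
    chainFunction L t b e x₀ x + inner ℝ (chainGradient L t b e x₀ x) (y - x) ≤
      chainFunction L t b e x₀ y := by
  refine le_trans (le_of_eq ?_)
    (chainObjective_le L t b (chainCoord e x₀ y) (chainArgmax_mem L t b (chainCoord e x₀ x)))
  simp only [chainFunction, chainGradient, chainObjective, sum_inner, real_inner_smul_left,
    ← Finset.sum_add_distrib, ← chainCoord_sub (x₀ := x₀)]
  exact Finset.sum_congr rfl fun i _ => by ring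

/-- The optimality conditions at `x` and `y`, each tested with the other's maximizer, are added. The
affine parts give the inner product and the penalties, of curvature `t i ^ 2 / L`, give the squared
norm. -/
theorem chainGradient_cocoercive (he : Orthonormal ℝ e) (hL : 0 < L)
    (x y : EuclideanSpace ℝ (Fin d)) :
    ‖chainGradient L t b e x₀ x - chainGradient L t b e x₀ y‖ ^ 2 ≤
      L * inner ℝ (chainGradient L t b e x₀ x - chainGradient L t b e x₀ y) (x - y) := by
  have hx := chainArgmax_variational L t b (chainCoord e x₀ x)
    (chainArgmax_mem L t b (chainCoord e x₀ y))
  have hy := chainArgmax_variational L t b (chainCoord e x₀ y)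
    (chainArgmax_mem L t b (chainCoord e x₀ x))
  have h1 : ‖chainGradient L t b e x₀ x - chainGradient L t b e x₀ y‖ ^ 2 =
      ∑ i, (t i * (chainArgmax L t b (chainCoord e x₀ x) i -
        chainArgmax L t b (chainCoord e x₀ y) i)) ^ 2 := by
    rw [chainGradient, chainGradient, ← Finset.sum_sub_distrib, ← real_inner_self_eq_norm_sq]
    simp only [← sub_smul, ← mul_sub]
    rw [he.inner_sum]
    exact Finset.sum_congr rfl fun i _ => by simp [sq]
  have h2 : inner ℝ (chainGradient L t b e x₀ x - chainGradient L t b e x₀ y) (x - y) =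
      ∑ i, t i * (chainArgmax L t b (chainCoord e x₀ x) i -
        chainArgmax L t b (chainCoord e x₀ y) i) *
        (chainCoord e x₀ x i - chainCoord e x₀ y i) := by
    rw [chainGradient, chainGradient, ← Finset.sum_sub_distrib]
    simp only [← sub_smul, ← mul_sub, sum_inner, real_inner_smul_left, chainCoord_sub]
  have h3 := add_nonpos hx hy
  rw [← Finset.sum_add_distrib] at h3
  have h4 : L * ∑ i, ((chainArgmax L t b (chainCoord e x₀ y) i -
      chainArgmax L t b (chainCoord e x₀ x) i) * (t i * chainCoord e x₀ x i + b i -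
        t i ^ 2 * chainArgmax L t b (chainCoord e x₀ x) i / L) +
      (chainArgmax L t b (chainCoord e x₀ x) i -
      chainArgmax L t b (chainCoord e x₀ y) i) * (t i * chainCoord e x₀ y i + b i -
        t i ^ 2 * chainArgmax L t b (chainCoord e x₀ y) i / L)) ≤ 0 :=
    mul_nonpos_of_nonneg_of_nonpos hL.le h3
  rw [h1, h2, ← sub_nonpos]
  refine le_trans (le_of_eq ?_) h4
  rw [Finset.mul_sum, Finset.mul_sum, ← Finset.sum_sub_distrib]
  refine Finset.sum_congr rfl fun i _ => ?_
  field_simp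
  ring

theorem chainGradient_lipschitz (he : Orthonormal ℝ e) (hL : 0 < L)
    (x y : EuclideanSpace ℝ (Fin d)) :
    ‖chainGradient L t b e x₀ x - chainGradient L t b e x₀ y‖ ≤ L * ‖x - y‖ := by
  have h := chainGradient_cocoercive (t := t) (b := b) (x₀ := x₀) he hL x y
  have h' := real_inner_le_norm
    (chainGradient L t b e x₀ x - chainGradient L t b e x₀ y) (x - y)
  rcases (norm_nonneg (chainGradient L t b e x₀ x - chainGradient L t b e x₀ y)).eq_or_lt
    with h0 | h0
  · rw [← h0]; positivity
  · nlinarith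

theorem hasGradientAt_chainFunction (he : Orthonormal ℝ e) (hL : 0 < L)
    (x : EuclideanSpace ℝ (Fin d)) :
    HasGradientAt (chainFunction L t b e x₀) (chainGradient L t b e x₀ x) x := by
  rw [hasGradientAt_iff_isLittleO]
  -- The subgradient inequalities at `x` and `y` trap the linearization error between `0` and the
  -- inner product of the gradient difference with `y - x`.
  have hO : (fun y => chainFunction L t b e x₀ y - chainFunction L t b e x₀ x -
      inner ℝ (chainGradient L t b e x₀ x) (y - x)) =O[nhds x] fun y => ‖y - x‖ ^ 2 := by
    refine Asymptotics.IsBigO.of_bound L (Filter.Eventually.of_forall fun y => ?_)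
    have h1 := chainFunction_subgradient (L := L) (t := t) (b := b) (e := e) (x₀ := x₀) x y
    have h2 := chainFunction_subgradient (L := L) (t := t) (b := b) (e := e) (x₀ := x₀) y x
    have h3 := real_inner_le_norm
      (chainGradient L t b e x₀ y - chainGradient L t b e x₀ x) (y - x)
    have h4 := chainGradient_lipschitz (t := t) (b := b) (x₀ := x₀) he hL y x
    have h5 : inner ℝ (chainGradient L t b e x₀ y) (x - y) =
        -inner ℝ (chainGradient L t b e x₀ y) (y - x) := by
      rw [← inner_neg_right, neg_sub]
    rw [inner_sub_left] at h3
    rw [Real.norm_of_nonneg (by linarith), Real.norm_of_nonneg (by positivity)]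
    nlinarith [norm_nonneg (y - x)]
  refine hO.trans_isLittleO ?_
  have := (Asymptotics.isLittleO_norm_pow_id (E' := EuclideanSpace ℝ (Fin d))
    one_lt_two).comp_tendsto (k := fun y => y - x) (l' := nhds x) (by
      have : Filter.Tendsto (fun y => y - x) (nhds x) (nhds (x - x)) :=
        (continuous_id.sub continuous_const).tendsto x
      simpa using this)
  exact this

theorem isSmoothConvex_chainFunction (he : Orthonormal ℝ e) (hL : 0 < L) :
    IsSmoothConvex L (chainFunction L t b e x₀) where
  convex := by
    refine ⟨convex_univ, fun x _ y _ p q hp hq hpq => ?_⟩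
    have h1 := chainFunction_subgradient (L := L) (t := t) (b := b) (e := e) (x₀ := x₀)
      (p • x + q • y) x
    have h2 := chainFunction_subgradient (L := L) (t := t) (b := b) (e := e) (x₀ := x₀)
      (p • x + q • y) y
    have h3 : p * inner ℝ (chainGradient L t b e x₀ (p • x + q • y)) (x - (p • x + q • y)) +
        q * inner ℝ (chainGradient L t b e x₀ (p • x + q • y)) (y - (p • x + q • y)) = 0 := by
      rw [← real_inner_smul_right, ← real_inner_smul_right, ← inner_add_right]
      have : p • (x - (p • x + q • y)) + q • (y - (p • x + q • y)) = 0 := by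
        have : q = 1 - p := by linarith
        subst this
        module
      rw [this, inner_zero_right]
    simp only [smul_eq_mul]
    have h4 := mul_le_mul_of_nonneg_left h1 hp
    have h5 := mul_le_mul_of_nonneg_left h2 hq
    have h6 : chainFunction L t b e x₀ (p • x + q • y) =
        p * chainFunction L t b e x₀ (p • x + q • y) +
        q * chainFunction L t b e x₀ (p • x + q • y) := by rw [← add_mul, hpq, one_mul]
    linarith
  differentiable := fun x => (hasGradientAt_chainFunction he hL x).differentiableAt
  lipschitz := fun x y => by
    rw [(hasGradientAt_chainFunction he hL x).gradient,
      (hasGradientAt_chainFunction he hL y).gradient]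
    exact chainGradient_lipschitz he hL x y

end ChainFunction

/-! ### The box, its projection and its indicator function. -/

section CoordinateBox

variable {d n : ℕ} {c : Fin (n + 1) → ℝ}
  {e : Fin (n + 1) → EuclideanSpace ℝ (Fin d)} {x₀ : EuclideanSpace ℝ (Fin d)}

/-- The points whose coordinates along `e`, relative to `x₀`, are at least `-c`. -/
def coordBox {d n : ℕ} (c : Fin (n + 1) → ℝ) (e : Fin (n + 1) → EuclideanSpace ℝ (Fin d))
    (x₀ : EuclideanSpace ℝ (Fin d)) : Set (EuclideanSpace ℝ (Fin d)) :=
  {x | ∀ i, -c i ≤ chainCoord e x₀ x i}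

/-- The projection onto the box. -/
noncomputable def coordBoxProj {d n : ℕ} (c : Fin (n + 1) → ℝ)
    (e : Fin (n + 1) → EuclideanSpace ℝ (Fin d)) (x₀ x : EuclideanSpace ℝ (Fin d)) :
    EuclideanSpace ℝ (Fin d) :=
  x + ∑ i, max 0 (-c i - chainCoord e x₀ x i) • e i

theorem isClosed_coordBox : IsClosed (coordBox c e x₀) := by
  simp only [coordBox, Set.ofPred_forall]
  refine isClosed_iInter fun i => isClosed_le continuous_const ?_
  unfold chainCoord
  fun_prop

theorem convex_coordBox : Convex ℝ (coordBox c e x₀) := by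
  intro x hx y hy p q hp hq hpq i
  have h : chainCoord e x₀ (p • x + q • y) i =
      p * chainCoord e x₀ x i + q * chainCoord e x₀ y i := by
    simp only [chainCoord, ← real_inner_smul_right, ← inner_add_right]
    congr 1
    have : q = 1 - p := by linarith
    subst this
    module
  rw [h]
  have h1 := mul_le_mul_of_nonneg_left (hx i) hp
  have h2 := mul_le_mul_of_nonneg_left (hy i) hq
  have h3 : -c i = p * -c i + q * -c i := by rw [← add_mul, hpq, one_mul]
  linarith

theorem chainCoord_self (i : Fin (n + 1)) : chainCoord e x₀ x₀ i = 0 := by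
  simp [chainCoord]

theorem mem_coordBox_self (hc : ∀ i, 0 ≤ c i) : x₀ ∈ coordBox c e x₀ := fun i => by
  rw [chainCoord_self]
  linarith [hc i]

theorem chainCoord_add_sum (he : Orthonormal ℝ e) (x : EuclideanSpace ℝ (Fin d))
    (r : Fin (n + 1) → ℝ) (i : Fin (n + 1)) :
    chainCoord e x₀ (x + ∑ j, r j • e j) i = chainCoord e x₀ x i + r i := by
  rw [chainCoord, chainCoord, add_sub_right_comm, inner_add_right, he.inner_right_fintype]

theorem coordBoxProj_mem (he : Orthonormal ℝ e) (x : EuclideanSpace ℝ (Fin d)) :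
    coordBoxProj c e x₀ x ∈ coordBox c e x₀ := fun i => by
  rw [coordBoxProj, chainCoord_add_sum he]
  linarith [le_max_right 0 (-c i - chainCoord e x₀ x i)]

theorem coordBoxProj_pythagoras (he : Orthonormal ℝ e) (x : EuclideanSpace ℝ (Fin d))
    {z : EuclideanSpace ℝ (Fin d)} (hz : z ∈ coordBox c e x₀) :
    ‖coordBoxProj c e x₀ x - x‖ ^ 2 + ‖z - coordBoxProj c e x₀ x‖ ^ 2 ≤ ‖z - x‖ ^ 2 := by
  have h1 : 0 ≤ inner ℝ (coordBoxProj c e x₀ x - x) (z - coordBoxProj c e x₀ x) := by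
    rw [show coordBoxProj c e x₀ x - x = ∑ i, max 0 (-c i - chainCoord e x₀ x i) • e i by
      rw [coordBoxProj, add_sub_cancel_left]]
    simp only [sum_inner, real_inner_smul_left, ← chainCoord_sub (x₀ := x₀)]
    refine Finset.sum_nonneg fun i _ => ?_
    rw [coordBoxProj, chainCoord_add_sum he]
    have := hz i
    -- Either coordinate `i` is not moved, or it lands exactly on `-c i`, the least value allowed to
    -- `z`.
    rcases max_cases 0 (-c i - chainCoord e x₀ x i) with ⟨h, _⟩ | ⟨h, h'⟩ <;> rw [h]
    · simp
    · exact mul_nonneg h'.le (by linarith)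
  have h2 : z - x = (coordBoxProj c e x₀ x - x) + (z - coordBoxProj c e x₀ x) := by abel
  rw [h2, norm_add_sq_real]
  linarith

theorem prox_convexIndicator_coordBox (he : Orthonormal ℝ e) {γ : ℝ} (hγ : 0 < γ)
    (x : EuclideanSpace ℝ (Fin d)) :
    prox γ (convexIndicator (coordBox c e x₀)) x = coordBoxProj c e x₀ x := by
  set p := coordBoxProj c e x₀ x with hp
  have hpC : p ∈ coordBox c e x₀ := coordBoxProj_mem he x
  have hval : ∀ z ∈ coordBox c e x₀, convexIndicator (coordBox c e x₀) z +
      ((‖z - x‖ ^ 2 / (2 * γ) : ℝ) : EReal) = ((‖z - x‖ ^ 2 / (2 * γ) : ℝ) : EReal) :=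
    fun z hz => by rw [convexIndicator, if_pos hz, zero_add]
  have hmin : IsMinOn (fun z => convexIndicator (coordBox c e x₀) z +
      ((‖z - x‖ ^ 2 / (2 * γ) : ℝ) : EReal)) Set.univ p := by
    refine isMinOn_univ_iff.2 fun z => ?_
    by_cases hz : z ∈ coordBox c e x₀
    · rw [hval z hz, hval p hpC, EReal.coe_le_coe_iff]
      have := coordBoxProj_pythagoras he x hz
      gcongr ?_ / _
      nlinarith [sq_nonneg ‖z - p‖]
    · rw [convexIndicator, convexIndicator, if_neg hz, EReal.top_add_coe]
      exact le_top
  -- `prox` is only some chosen minimizer; the Pythagorean inequality shows that it must be the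
  -- projection.
  have hq : IsMinOn (fun z => convexIndicator (coordBox c e x₀) z +
      ((‖z - x‖ ^ 2 / (2 * γ) : ℝ) : EReal)) Set.univ
      (prox γ (convexIndicator (coordBox c e x₀)) x) := Classical.epsilon_spec ⟨p, hmin⟩
  set q := prox γ (convexIndicator (coordBox c e x₀)) x
  have hle := isMinOn_univ_iff.1 hq p
  have hqC : q ∈ coordBox c e x₀ := by
    by_contra hqC
    rw [hval p hpC, convexIndicator, if_neg hqC, EReal.top_add_coe, top_le_iff] at hle
    exact EReal.coe_ne_top _ hle
  rw [hval p hpC, hval q hqC, EReal.coe_le_coe_iff,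
    div_le_div_iff_of_pos_right (by positivity)] at hle
  have := coordBoxProj_pythagoras he x hqC
  have h0 : ‖q - p‖ ^ 2 ≤ 0 := by linarith
  have h1 : ‖q - p‖ = 0 := by nlinarith [norm_nonneg (q - p)]
  exact sub_eq_zero.1 (norm_eq_zero.1 h1)

theorem isClosedConvexProper_convexIndicator {C : Set (EuclideanSpace ℝ (Fin d))}
    (hne : C.Nonempty) (hcl : IsClosed C) (hconv : Convex ℝ C) :
    IsClosedConvexProper (convexIndicator C) where
  ne_bot := fun x => by
    rw [convexIndicator]
    split_ifs <;> simp
  exists_ne_top := by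
    obtain ⟨x, hx⟩ := hne
    exact ⟨x, by simp [convexIndicator, hx]⟩
  convex := fun x y t h0 h1 => by
    by_cases hx : x ∈ C
    · by_cases hy : y ∈ C
      · have := hconv hx hy h0.le (sub_nonneg.2 h1.le) (by ring)
        simp [convexIndicator, hx, hy, this]
      · simp only [convexIndicator, hx, hy, if_true, if_false, mul_zero, zero_add]
        rw [EReal.coe_mul_top_of_pos (sub_pos.2 h1)]
        exact le_top
    · have hy : ((1 - t : ℝ) : EReal) * convexIndicator C y ≠ ⊥ := by
        by_cases hy : y ∈ C
        · simp [convexIndicator, hy]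
        · simp only [convexIndicator, hy, if_false]
          rw [EReal.coe_mul_top_of_pos (sub_pos.2 h1)]
          simp
      rw [show convexIndicator C x = ⊤ by simp [convexIndicator, hx],
        EReal.coe_mul_top_of_pos h0, EReal.top_add_of_ne_bot hy]
      exact le_top
  closed := fun x a ha => by
    by_cases hx : x ∈ C
    · have ha0 : a < 0 := by simpa [convexIndicator, hx] using ha
      refine Filter.Eventually.of_forall fun y => lt_of_lt_of_le ha0 ?_
      rw [convexIndicator]
      split_ifs <;> simp
    · filter_upwards [hcl.isOpen_compl.mem_nhds hx] with y hy
      simp only [convexIndicator, hx, if_false] at ha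
      simpa [convexIndicator, show y ∉ C from hy] using ha

end CoordinateBox

/-! ### The resisting oracle: hidden directions and unchanged transcripts. -/

section ResistingOracle

/-- The number of gradient queries in a history. -/
def gradientCount {d : ℕ} (H : List (OracleQuery d × OracleAnswer d)) : ℕ :=
  H.countP (fun s => s.1.kind = OracleKind.gradient)

variable {d n : ℕ} {L : ℝ} {t b c : Fin (n + 1) → ℝ} {x₀ : EuclideanSpace ℝ (Fin d)}

/-- The history of the first `k` queries on the chain function and the box built on `e`. -/
noncomputable def chainHistory {d n : ℕ} (L : ℝ) (t b c : Fin (n + 1) → ℝ)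
    (x₀ : EuclideanSpace ℝ (Fin d)) (A : DoubleOracleStrategy d)
    (e : Fin (n + 1) → EuclideanSpace ℝ (Fin d)) (k : ℕ) :
    List (OracleQuery d × OracleAnswer d) :=
  A.history (chainFunction L t b e x₀) (convexIndicator (coordBox c e x₀)) x₀ k

/-- The answers to a query orthogonal to all `e j` with `m ≤ j` involve only the directions `e j`
with `j < m`, and in addition `e m` for a gradient query. -/
theorem oracleAnswer_congr (hL : 0 < L) (ht : ∀ i, 0 < t i)
    (hb : ∀ i j, i < j → b j ≤ b i - t i ^ 2 / L) (hc : ∀ i, 0 < c i)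
    {e e' : Fin (n + 1) → EuclideanSpace ℝ (Fin d)} (he : Orthonormal ℝ e)
    (he' : Orthonormal ℝ e') (q : OracleQuery d) (m : ℕ)
    (horth : ∀ j : Fin (n + 1), m ≤ j → chainCoord e x₀ q.point j = 0)
    (horth' : ∀ j : Fin (n + 1), m ≤ j → chainCoord e' x₀ q.point j = 0)
    (heq : ∀ j : Fin (n + 1), (j : ℕ) < m → e j = e' j)
    (hgrad : q.kind = OracleKind.gradient → ∀ j : Fin (n + 1), (j : ℕ) = m → e j = e' j) :
    oracleAnswer (chainFunction L t b e' x₀) (convexIndicator (coordBox c e' x₀)) q =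
      oracleAnswer (chainFunction L t b e x₀) (convexIndicator (coordBox c e x₀)) q := by
  -- Equal coordinates give the same chosen maximizer, so the two answers can differ only through
  -- directions that carry a nonzero coefficient.
  have hcoord : chainCoord e' x₀ q.point = chainCoord e x₀ q.point := by
    ext j
    rcases lt_or_ge (j : ℕ) m with h | h
    · rw [chainCoord, chainCoord, heq j h]
    · rw [horth j h, horth' j h]
  rw [oracleAnswer, oracleAnswer]
  cases hk : q.kind with
  | gradient =>
    simp only
    rw [(hasGradientAt_chainFunction he hL q.point).gradient,
      (hasGradientAt_chainFunction he' hL q.point).gradient]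
    congr 1
    · rw [chainGradient, chainGradient, hcoord]
      refine Finset.sum_congr rfl fun j _ => ?_
      rcases le_or_gt (j : ℕ) m with h | h
      · rcases h.lt_or_eq with h | h
        · rw [heq j h]
        · rw [hgrad hk j h]
      · have : chainArgmax L t b (chainCoord e x₀ q.point) j = 0 :=
          chainArgmax_eq_zero hL ht hb (m := ⟨m, h.trans j.2⟩)
            (fun i hi => horth i (Fin.le_def.1 hi)) (Fin.lt_def.2 h)
        rw [this]
        simp
    · rw [chainFunction, chainFunction, hcoord]
  | proximal =>
    simp only
    rw [prox_convexIndicator_coordBox he q.stepsize.2,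
      prox_convexIndicator_coordBox he' q.stepsize.2]
    congr 1
    · rw [coordBoxProj, coordBoxProj, hcoord]
      congr 1
      refine Finset.sum_congr rfl fun j _ => ?_
      rcases lt_or_ge (j : ℕ) m with h | h
      · rw [heq j h]
      -- A vanishing coordinate already satisfies its constraint, so the projection does not move
      -- along `e j`.
      · rw [horth j h, max_eq_left (by linarith [hc j])]
        simp
    · have : q.point ∈ coordBox c e' x₀ ↔ q.point ∈ coordBox c e x₀ := by
        simp only [coordBox, Set.mem_ofPred_eq, hcoord]
      by_cases hC : q.point ∈ coordBox c e x₀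
      · rw [convexIndicator, convexIndicator, if_pos hC, if_pos (this.2 hC)]
      · rw [convexIndicator, convexIndicator, if_neg hC, if_neg (mt this.1 hC)]

/-- Each of the first `k` queries is orthogonal to the directions that the gradient queries before
it have not revealed, and these queries lie in `x₀ + V`. -/
structure IsHidden {d n : ℕ} (L : ℝ) (t b c : Fin (n + 1) → ℝ)
    (x₀ : EuclideanSpace ℝ (Fin d)) (A : DoubleOracleStrategy d)
    (e : Fin (n + 1) → EuclideanSpace ℝ (Fin d)) (k : ℕ)
    (V : Submodule ℝ (EuclideanSpace ℝ (Fin d))) : Prop where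
  orthonormal : Orthonormal ℝ e
  mem : ∀ i, i < k → (A.query x₀ (chainHistory L t b c x₀ A e i)).point - x₀ ∈ V
  orthogonal : ∀ i, i < k → ∀ j : Fin (n + 1), gradientCount (chainHistory L t b c x₀ A e i) ≤ j →
    chainCoord e x₀ (A.query x₀ (chainHistory L t b c x₀ A e i)).point j = 0

theorem chainHistory_succ (A : DoubleOracleStrategy d)
    (e : Fin (n + 1) → EuclideanSpace ℝ (Fin d)) (k : ℕ) :
    chainHistory L t b c x₀ A e (k + 1) = chainHistory L t b c x₀ A e k ++
      [(A.query x₀ (chainHistory L t b c x₀ A e k),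
        oracleAnswer (chainFunction L t b e x₀) (convexIndicator (coordBox c e x₀))
          (A.query x₀ (chainHistory L t b c x₀ A e k)))] := rfl

theorem gradientCount_chainHistory_mono (A : DoubleOracleStrategy d)
    (e : Fin (n + 1) → EuclideanSpace ℝ (Fin d)) :
    Monotone fun k => gradientCount (chainHistory L t b c x₀ A e k) :=
  monotone_nat_of_le_succ fun k => by
    simp only [chainHistory_succ, gradientCount, List.countP_append]
    omega

theorem gradientCount_chainHistory_succ {A : DoubleOracleStrategy d}
    {e : Fin (n + 1) → EuclideanSpace ℝ (Fin d)} {k : ℕ}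
    (h : (A.query x₀ (chainHistory L t b c x₀ A e k)).kind = OracleKind.gradient) :
    gradientCount (chainHistory L t b c x₀ A e (k + 1)) =
      gradientCount (chainHistory L t b c x₀ A e k) + 1 := by
  simp [chainHistory_succ, gradientCount, List.countP_append, h]

/-- Replacing the directions from `m` on by new ones orthogonal to `W`. -/
theorem exists_orthonormal_replace {e : Fin (n + 1) → EuclideanSpace ℝ (Fin d)}
    (he : Orthonormal ℝ e) (W : Submodule ℝ (EuclideanSpace ℝ (Fin d)))
    (hW : Module.finrank ℝ W + (n + 1) ≤ d) (m : ℕ) :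
    ∃ e' : Fin (n + 1) → EuclideanSpace ℝ (Fin d), Orthonormal ℝ e' ∧
      (∀ j : Fin (n + 1), (j : ℕ) < m → e j = e' j) ∧
      ∀ j : Fin (n + 1), m ≤ j → ∀ y ∈ W, inner ℝ (e' j) y = 0 := by
  by_cases hm : n + 1 ≤ m
  · exact ⟨e, he, fun _ _ => rfl, fun j hj => absurd (hm.trans hj) (by omega)⟩
  push Not at hm
  let e₁ : Fin m → EuclideanSpace ℝ (Fin d) := fun i => e ⟨i, i.2.trans hm⟩
  let S := W ⊔ Submodule.span ℝ (Set.range e₁)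
  have hS : Module.finrank ℝ S ≤ Module.finrank ℝ W + m := by
    refine (Submodule.finrank_add_le_finrank_add_finrank _ _).trans ?_
    gcongr
    simpa [Set.finrank] using finrank_range_le_card (R := ℝ) e₁
  have hSd : n + 1 ≤ Module.finrank ℝ Sᗮ + m := by
    have := Submodule.finrank_add_finrank_orthogonal S
    rw [finrank_euclideanSpace_fin] at this
    omega
  -- The complement of `W` and the kept directions has room for the `n + 1 - m` replacements.
  let B := stdOrthonormalBasis ℝ Sᗮ
  let e' : Fin (n + 1) → EuclideanSpace ℝ (Fin d) := fun j =>
    if h : (j : ℕ) < m then e j else (B ⟨j - m, by omega⟩ : EuclideanSpace ℝ (Fin d))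
  have hlt : ∀ j : Fin (n + 1), (j : ℕ) < m → e' j = e j := fun j h => dif_pos h
  have hge : ∀ j : Fin (n + 1), ¬ (j : ℕ) < m → e' j ∈ Sᗮ := fun j h => by
    simp only [e', dif_neg h, Submodule.coe_mem]
  have hperp : ∀ j : Fin (n + 1), ¬ (j : ℕ) < m → ∀ y ∈ S, inner ℝ (e' j) y = 0 :=
    fun j h y hy => Submodule.inner_left_of_mem_orthogonal hy (hge j h)
  have heS : ∀ j : Fin (n + 1), (j : ℕ) < m → e j ∈ S := fun j h =>
    Submodule.mem_sup_right (Submodule.subset_span ⟨⟨j, h⟩, rfl⟩)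
  refine ⟨e', ⟨fun j => ?_, fun i j hij => ?_⟩, fun j h => (hlt j h).symm,
    fun j h y hy => hperp j (not_lt.2 h) y (Submodule.mem_sup_left hy)⟩
  · by_cases h : (j : ℕ) < m
    · rw [hlt j h, he.1]
    · simp only [e', dif_neg h]
      exact B.orthonormal.1 _
  · show inner ℝ (e' i) (e' j) = 0
    by_cases hi : (i : ℕ) < m <;> by_cases hj : (j : ℕ) < m
    · rw [hlt i hi, hlt j hj, he.2 hij]
    · rw [real_inner_comm, hlt i hi]
      exact hperp j hj _ (heS i hi)
    · rw [hlt j hj]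
      exact hperp i hi _ (heS j hj)
    · simp only [e', dif_neg hi, dif_neg hj]
      refine B.orthonormal.2 fun h => hij (Fin.ext ?_)
      have := Fin.mk.inj_iff.1 h
      omega

/-- The directions not revealed by the first `k` queries can be made orthogonal to a further vector
without changing the history. -/
theorem IsHidden.exists_replace (hL : 0 < L) (ht : ∀ i, 0 < t i)
    (hb : ∀ i j, i < j → b j ≤ b i - t i ^ 2 / L) (hc : ∀ i, 0 < c i)
    {A : DoubleOracleStrategy d} {e : Fin (n + 1) → EuclideanSpace ℝ (Fin d)} {k : ℕ}
    {V W : Submodule ℝ (EuclideanSpace ℝ (Fin d))} (h : IsHidden L t b c x₀ A e k V)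
    (hVW : V ≤ W) (hW : Module.finrank ℝ W + (n + 1) ≤ d) :
    ∃ e', IsHidden L t b c x₀ A e' k W ∧
      chainHistory L t b c x₀ A e' k = chainHistory L t b c x₀ A e k ∧
      ∀ j : Fin (n + 1), gradientCount (chainHistory L t b c x₀ A e k) ≤ j →
        ∀ y ∈ W, inner ℝ (e' j) y = 0 := by
  obtain ⟨e', he', heq, hperp⟩ := exists_orthonormal_replace h.orthonormal W hW
    (gradientCount (chainHistory L t b c x₀ A e k))
  have horth : ∀ i, i < k → ∀ j : Fin (n + 1),
      gradientCount (chainHistory L t b c x₀ A e i) ≤ j →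
      chainCoord e' x₀ (A.query x₀ (chainHistory L t b c x₀ A e i)).point j = 0 := by
    intro i hi j hj
    rcases lt_or_ge (j : ℕ) (gradientCount (chainHistory L t b c x₀ A e k)) with hk | hk
    · rw [← h.orthogonal i hi j hj, chainCoord, chainCoord, heq j hk]
    · exact hperp j hk _ (hVW (h.mem i hi))
  have hhist : ∀ i, i ≤ k → chainHistory L t b c x₀ A e' i = chainHistory L t b c x₀ A e i := by
    intro i
    induction i with
    | zero => intro _; rfl
    | succ i ih =>
      intro hi
      rw [chainHistory_succ, chainHistory_succ, ih (by omega)]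
      congr 3
      have hmono := gradientCount_chainHistory_mono (L := L) (t := t) (b := b) (c := c)
        (x₀ := x₀) A e
      refine oracleAnswer_congr hL ht hb hc h.orthonormal he' _ _ (h.orthogonal i hi)
        (horth i hi) (fun j hj => heq j (hj.trans_le (hmono (by omega)))) fun hg j hj => ?_
      -- The direction that a gradient query may reveal has as index the count before that query;
      -- the query raises the count, so this direction is among those kept.
      refine heq j (lt_of_lt_of_le ?_ (hmono hi))
      simp only [gradientCount_chainHistory_succ hg]
      omega
  refine ⟨e', ⟨he', fun i hi => ?_, fun i hi => ?_⟩, hhist k le_rfl, hperp⟩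
  · rw [hhist i hi.le]
    exact hVW (h.mem i hi)
  · rw [hhist i hi.le]
    exact horth i hi

theorem finrank_sup_span_singleton_le (V : Submodule ℝ (EuclideanSpace ℝ (Fin d)))
    (y : EuclideanSpace ℝ (Fin d)) :
    Module.finrank ℝ ↥(V ⊔ Submodule.span ℝ {y}) ≤ Module.finrank ℝ V + 1 := by
  refine (Submodule.finrank_add_le_finrank_add_finrank _ _).trans ?_
  gcongr
  simpa using finrank_span_le_card (R := ℝ) ({y} : Set (EuclideanSpace ℝ (Fin d)))

/-- Every deterministic strategy meets directions that stay hidden during the first `k + 1`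
queries. -/
theorem exists_isHidden (hL : 0 < L) (ht : ∀ i, 0 < t i)
    (hb : ∀ i j, i < j → b j ≤ b i - t i ^ 2 / L) (hc : ∀ i, 0 < c i)
    (A : DoubleOracleStrategy d) (k : ℕ) (hk : k + (n + 1) ≤ d) :
    ∃ e V, IsHidden L t b c x₀ A e (k + 1) V ∧ Module.finrank ℝ V ≤ k := by
  induction k with
  | zero =>
    have hquery : ∀ e i, i < 0 + 1 →
        (A.query x₀ (chainHistory L t b c x₀ A e i)).point = x₀ := by
      intro e i hi
      obtain rfl : i = 0 := by omega
      rfl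
    -- The first query is `x₀`, with all coordinates zero, so it costs no dimension: `k + 1` queries
    -- need only dimension `k`.
    refine ⟨fun j => EuclideanSpace.basisFun (Fin d) ℝ ⟨j, by omega⟩, ⊥, ⟨?_, ?_, ?_⟩, by simp⟩
    · exact (EuclideanSpace.basisFun (Fin d) ℝ).orthonormal.comp _
        fun i j hij => Fin.ext (Fin.mk.inj_iff.1 hij)
    · intro i hi
      simp [hquery _ i hi]
    · intro i hi j _
      rw [hquery _ i hi, chainCoord_self]
  | succ k ih =>
    obtain ⟨e, V, h, hV⟩ := ih (by omega)
    set y := (A.query x₀ (chainHistory L t b c x₀ A e (k + 1))).point with hy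
    have hW := finrank_sup_span_singleton_le V (y - x₀)
    obtain ⟨e', h', hhist, hperp⟩ := h.exists_replace hL ht hb hc
      (W := V ⊔ Submodule.span ℝ {y - x₀}) le_sup_left (by omega)
    have hyW : y - x₀ ∈ V ⊔ Submodule.span ℝ {y - x₀} :=
      Submodule.mem_sup_right (Submodule.mem_span_singleton_self _)
    refine ⟨e', _, ⟨h'.orthonormal, fun i hi => ?_, fun i hi j hj => ?_⟩, hW.trans (by omega)⟩
    · rcases (Nat.lt_succ_iff.1 hi).lt_or_eq with hi | rfl
      · exact h'.mem i hi
      · rw [hhist]; exact hyW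
    · rcases (Nat.lt_succ_iff.1 hi).lt_or_eq with hi | rfl
      · exact h'.orthogonal i hi j hj
      · rw [hhist] at hj ⊢
        exact hperp j hj _ hyW

end ResistingOracle

/-! ### Parameters of the instance and the lower bound. -/

section LowerBound

theorem chainObjective_le_chainFunction {d n : ℕ} {L : ℝ} {t b α : Fin (n + 1) → ℝ}
    {e : Fin (n + 1) → EuclideanSpace ℝ (Fin d)} {x₀ : EuclideanSpace ℝ (Fin d)}
    (hα : α ∈ stdSimplex ℝ (Fin (n + 1))) (x : EuclideanSpace ℝ (Fin d)) :
    chainObjective L t b (chainCoord e x₀ x) α ≤ chainFunction L t b e x₀ x :=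
  chainObjective_le L t b _ hα

/-- The parameters of the worst-case instance. -/
theorem exists_worst_case_parameters {L R : ℝ} (hL : 0 < L) (hR : 0 < R) {N : ℕ} (hN : 0 < N) :
    ∃ (w t b c : Fin (N + 1) → ℝ) (v : ℝ), w ∈ stdSimplex ℝ (Fin (N + 1)) ∧
      (∀ i, 0 < t i) ∧ (∀ i, 0 < c i) ∧ (∀ i j, i < j → b j ≤ b i - t i ^ 2 / L) ∧
      (∀ i, b i = t i * c i + t i ^ 2 * w i / L) ∧
      ∑ i, c i ^ 2 = R ^ 2 ∧ ∑ i, t i ^ 2 * w i ^ 2 / (2 * L) = v ∧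
      b (Fin.last N) - t (Fin.last N) ^ 2 / (2 * L) - v =
        L * R ^ 2 / (2 * (theta N N ^ 2 - 1)) := by
  obtain ⟨w, s, hw, hs, hw1, hrec, hlast, hs1⟩ := exists_worst_case_weights hN
  have hθ := one_lt_theta_last hN
  set θ := theta N N
  have hθ2 : 0 < θ ^ 2 - 1 := by nlinarith
  set κ := 1 / (θ ^ 2 - 1) with hκ
  have hκ0 : 0 < κ := by positivity
  -- This identity makes each `b` drop to the next by exactly `t k ^ 2 / L`, the least drop that
  -- keeps later directions inactive.
  have hκθ : κ * (1 + κ) * (1 / θ ^ 2) = κ ^ 2 := by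
    rw [hκ]
    field_simp
    ring
  have hsq : ∀ k, k ≤ N → √(s k) ^ 2 = s k := fun k hk => Real.sq_sqrt (hs k hk).le
  have hsq' : ∀ i : Fin (N + 1), √(s i) ^ 2 = s i := fun i => hsq i (Nat.lt_succ_iff.1 i.2)
  have hsp : ∀ i : Fin (N + 1), 0 < √(s i) := fun i =>
    Real.sqrt_pos.2 (hs i (Nat.lt_succ_iff.1 i.2))
  let β : ℕ → ℝ := fun k => L * R ^ 2 * (κ * (1 + κ)) * (s k * w k)
  have hβ : ∀ k, k < N → β (k + 1) = β k - L * R ^ 2 * κ ^ 2 * s k := fun k hk => by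
    simp only [β]
    rw [← hrec k hk, ← hκθ]
    ring
  have hβle : ∀ k j, k < j → j ≤ N → β j ≤ β k - L * R ^ 2 * κ ^ 2 * s k := by
    intro k j hkj
    induction j, hkj using Nat.le_induction with
    | base => intro h; exact (hβ k h).le
    | succ j hj ih =>
      intro h
      have := ih (by omega)
      have h0 := hs j (by omega)
      rw [hβ j h]
      have : 0 ≤ L * R ^ 2 * κ ^ 2 * s j := by positivity
      linarith
  have htL : ∀ i : Fin (N + 1), (L * R * κ * √(s i)) ^ 2 / L = L * R ^ 2 * κ ^ 2 * s i :=
    fun i => by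
      rw [mul_pow, hsq']
      field_simp
  have htw : ∀ i : Fin (N + 1), (L * R * κ * √(s i)) ^ 2 * w i ^ 2 / (2 * L) =
      L * R ^ 2 * κ ^ 2 / 2 * (s i * w i ^ 2) := fun i => by
    rw [mul_pow, hsq']
    field_simp
  refine ⟨fun i => w i, fun i => L * R * κ * √(s i), fun i => β i, fun i => R * w i * √(s i),
    L * R ^ 2 * κ ^ 2 / 2, ⟨fun i => (hw i).le, ?_⟩, fun i => ?_, fun i => ?_, fun i j hij => ?_,
    fun i => ?_, ?_, ?_, ?_⟩
  · rw [Fin.sum_univ_eq_sum_range, hw1]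
  · have := hsp i
    positivity
  · have := hsp i
    have := hw i
    positivity
  · rw [htL]
    exact hβle i j hij (Nat.lt_succ_iff.1 j.2)
  · simp only [β]
    rw [mul_div_right_comm, htL]
    linear_combination (-(L * R ^ 2 * κ * w i)) * hsq' i
  · have : ∀ i : Fin (N + 1), (R * w i * √(s i)) ^ 2 = R ^ 2 * (s i * w i ^ 2) := fun i => by
      rw [mul_pow, hsq']
      ring
    simp only [this, ← Finset.mul_sum]
    rw [Fin.sum_univ_eq_sum_range (fun k => s k * w k ^ 2), hs1, mul_one]
  · simp only [htw, ← Finset.mul_sum]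
    rw [Fin.sum_univ_eq_sum_range (fun k => s k * w k ^ 2), hs1, mul_one]
  · have h1 : (L * R * κ * √(s N)) ^ 2 / (2 * L) = L * R ^ 2 * κ ^ 2 * s N / 2 := by
      rw [mul_comm 2 L, ← div_div, mul_pow, hsq N le_rfl]
      field_simp
    have h2 : L * R ^ 2 / (2 * (θ ^ 2 - 1)) = L * R ^ 2 * κ / 2 := by
      rw [hκ]
      field_simp
    simp only [Fin.val_last, β]
    rw [h1, h2]
    linear_combination (L * R ^ 2 * s N / 2) * hκθ + (L * R ^ 2 * (κ * (1 + κ)) / 2) * hlast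

theorem theorem4 (L R : ℝ) (hL : 0 < L) (hR : 0 < R) (N d : ℕ) (hN : 0 < N)
    (hd : 3 * N + 1 ≤ d) (x₀ : EuclideanSpace ℝ (Fin d)) (A : DoubleOracleMethod d N L) :
    ∃ (f : EuclideanSpace ℝ (Fin d) → ℝ) (h : EuclideanSpace ℝ (Fin d) → EReal),
      IsSmoothConvex L f ∧ IsConvexIndicator h ∧
      ∃ xs : EuclideanSpace ℝ (Fin d),
        IsMinOn (fun x => (f x : EReal) + h x) Set.univ xs ∧
        ‖x₀ - xs‖ = R ∧
        ((L * ‖x₀ - xs‖ ^ 2 / (2 * (theta N N ^ 2 - 1)) : ℝ) : EReal) ≤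
          (f (A.result f h x₀) : EReal) + h (A.result f h x₀) - (f xs : EReal) - h xs := by
  obtain ⟨w, t, b, c, v, hw, ht, hc, hb, hbtc, hcR, hv, hgap⟩ :=
    exists_worst_case_parameters hL hR hN
  -- Dimension count: `2 * N - 1` for the queries after the first, `1` for the output and `N + 1`
  -- for the directions, in total `3 * N + 1`.
  obtain ⟨e₁, V, he₁, hV⟩ := exists_isHidden (x₀ := x₀) hL ht hb hc A.toDoubleOracleStrategy
    (2 * N - 1) (by omega)
  rw [show 2 * N - 1 + 1 = 2 * N by omega] at he₁
  set y := A.output (chainHistory L t b c x₀ A.toDoubleOracleStrategy e₁ (2 * N)) with hy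
  have hW := finrank_sup_span_singleton_le V (y - x₀)
  obtain ⟨e, he, hhist, hperp⟩ := he₁.exists_replace hL ht hb hc
    (W := V ⊔ Submodule.span ℝ {y - x₀}) le_sup_left (by omega)
  have heo := he.orthonormal
  have hsmooth := isSmoothConvex_chainFunction (t := t) (b := b) (x₀ := x₀) heo hL
  have hne : (coordBox c e x₀).Nonempty := ⟨x₀, mem_coordBox_self fun i => (hc i).le⟩
  have hproper := isClosedConvexProper_convexIndicator hne isClosed_coordBox convex_coordBox
  have hcount : gradientCount (chainHistory L t b c x₀ A.toDoubleOracleStrategy e (2 * N)) = N :=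
    A.gradient_count _ _ x₀ hsmooth hproper
  have hresult : A.result (chainFunction L t b e x₀) (convexIndicator (coordBox c e x₀)) x₀ = y :=
    congrArg A.output hhist
  have hyN : chainCoord e x₀ y (Fin.last N) = 0 := by
    refine hperp (Fin.last N) ?_ _
      (Submodule.mem_sup_right (Submodule.mem_span_singleton_self _))
    rw [← hhist, hcount, Fin.val_last]
  set xs := x₀ + ∑ i, (-c i) • e i with hxs
  have hxsc : ∀ i, chainCoord e x₀ xs i = -c i := fun i => by
    rw [hxs, chainCoord_add_sum heo, chainCoord_self, zero_add]
  have hxsC : xs ∈ coordBox c e x₀ := fun i => (hxsc i).ge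
  have hnorm : ‖x₀ - xs‖ = R := by
    have h1 : x₀ - xs = ∑ i, c i • e i := by
      rw [hxs, sub_add_cancel_left, ← Finset.sum_neg_distrib]
      simp
    have h2 : ‖x₀ - xs‖ ^ 2 = R ^ 2 := by
      rw [h1, ← real_inner_self_eq_norm_sq, heo.inner_sum, ← hcR]
      exact Finset.sum_congr rfl fun i _ => by simp [sq]
    exact (sq_eq_sq₀ (norm_nonneg _) hR.le).1 h2
  have hupper : chainFunction L t b e x₀ xs ≤ v := by
    rw [chainFunction, ← hv, chainObjective]
    refine Finset.sum_le_sum fun i _ => ?_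
    set α := chainArgmax L t b (chainCoord e x₀ xs) i
    rw [hxsc, hbtc]
    -- By the choice of `b`, the coefficient of `α i` at the corner is `t i ^ 2 * w i / L`;
    -- completing the square shows that `w` is optimal there.
    have h1 : t i ^ 2 * w i ^ 2 / (2 * L) -
        (α * (t i * -c i + (t i * c i + t i ^ 2 * w i / L)) - t i ^ 2 * α ^ 2 / (2 * L)) =
        t i ^ 2 * (α - w i) ^ 2 / (2 * L) := by
      field_simp
      ring
    have h2 : 0 ≤ t i ^ 2 * (α - w i) ^ 2 / (2 * L) := by positivity
    linarith
  have hlower : ∀ x ∈ coordBox c e x₀, v ≤ chainFunction L t b e x₀ x := by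
    intro x hx
    -- With the weights fixed at `w`, the objective is nondecreasing in each coordinate, so over the
    -- box it is least at the corner.
    refine le_trans ?_ (chainObjective_le_chainFunction hw x)
    rw [← hv, chainObjective]
    refine Finset.sum_le_sum fun i _ => ?_
    rw [hbtc]
    have h1 : 0 ≤ w i * (t i * (chainCoord e x₀ x i + c i)) :=
      mul_nonneg (hw.1 i) (mul_nonneg (ht i).le (by linarith [hx i]))
    have h2 : w i * (t i * chainCoord e x₀ x i + (t i * c i + t i ^ 2 * w i / L)) -
        t i ^ 2 * w i ^ 2 / (2 * L) =
        w i * (t i * (chainCoord e x₀ x i + c i)) + t i ^ 2 * w i ^ 2 / (2 * L) := by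
      field_simp
      ring
    linarith
  have hyval : b (Fin.last N) - t (Fin.last N) ^ 2 / (2 * L) ≤ chainFunction L t b e x₀ y := by
    refine le_trans (le_of_eq ?_) (chainObjective_le_chainFunction (single_mem_stdSimplex ℝ (Fin.last N)) y)
    rw [chainObjective, Finset.sum_eq_single (Fin.last N)]
    · simp [hyN]
    · intro i _ hi
      simp [Pi.single_eq_of_ne hi]
    · simp
  refine ⟨chainFunction L t b e x₀, convexIndicator (coordBox c e x₀), hsmooth,
    ⟨_, hne, isClosed_coordBox, convex_coordBox, rfl⟩, xs, ?_, hnorm, ?_⟩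
  · refine isMinOn_univ_iff.2 fun x => ?_
    by_cases hx : x ∈ coordBox c e x₀
    · simp only [convexIndicator, hx, hxsC, if_true, add_zero, EReal.coe_le_coe_iff]
      exact hupper.trans (hlower x hx)
    · simp only [convexIndicator, hx, if_false, EReal.coe_add_top]
      exact le_top
  · rw [hresult, hnorm, show convexIndicator (coordBox c e x₀) xs = 0 from if_pos hxsC, sub_zero]
    by_cases hyC : y ∈ coordBox c e x₀
    · rw [show convexIndicator (coordBox c e x₀) y = 0 from if_pos hyC, add_zero,
        ← EReal.coe_sub, EReal.coe_le_coe_iff, ← hgap]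
      linarith
    · rw [show convexIndicator (coordBox c e x₀) y = ⊤ from if_neg hyC, EReal.coe_add_top,
        EReal.top_sub_coe]
      exact le_top

end LowerBound
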